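/- Setting. Let $(S,X)\sim P_{SX}$ be a pair of random variables, $P_{Z|Y}$ a channel, $\mathsf d_s:\mathcal S\times\hat{\mathcal S}\to[0,\infty)$ and $\mathsf d_x:\mathcal X\times\hat{\mathcal X}\to[0,\infty)$ measurable distortion measures, and $\mathsf D_s,\mathsf D_x\ge 0$; the $\sigma$-algebras of $\mathcal X$ and $\mathcal Z$ are countably generated. An encoder $P_{Y|X}$ (which sees only $X$) and a decoder $P_{\hat X\hat S|Z}$, both possibly random, induce the law $P_{SXYZ\hat X\hat S}=P_{SX}P_{Y|X}P_{Z|Y}P_{\hat X\hat S|Z}$. The tuple $(\mathsf D_s,\mathsf D_x,\epsilon)$ is achievable with the decoder $P_{\hat X\hat S|Z}$ if, for some encoder, $$\mathbb P\big[\mathsf d_s(S,\hat S)>\mathsf D_s\ \text{ or }\ \mathsf d_x(X,\hat X)>\mathsf D_x\big]\le\epsilon ,$$ and it is achievable if it is achievable with some decoder. Let $\mathsf d:[0,\infty)^2\to\mathbb R$ be non-decreasing in each argument. For a conditional law $Q_{X|\hat X\hat S}$ and $\lambda\ge 0$ put $$\jmath_{S,X}(x,s,\hat x,\hat s)=\log\frac{dQ_{X|\hat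 X=\hat x,\hat S=\hat s}}{dP_X}(x)+\lambda\big[\mathsf d(\mathsf d_s(s,\hat s),\mathsf d_x(x,\hat x))-\mathsf d(\mathsf D_s,\mathsf D_x)\big],\qquad \imath_{Y;\bar Z}(y;z)=\log\frac{dP_{Z|Y=y}}{dP_{\bar Z}}(z),$$ where each logarithm equals $+\infty$ on the part of the first law that is singular to the second, and $\infty-\infty=-\infty$. The tilted information of the source is the case in which $Q$ is a version of the backward channel $P_{X|\hat X^\star\hat S^\star}$ of a minimizer of $$R(t)=\inf\{I(X;\hat X,\hat S):\ S-X-(\hat X,\hat S),\ \mathbb E[\mathsf d(\mathsf d_s(S,\hat S),\mathsf d_x(X,\hat X))]\le t\}$$ at $t=\mathsf d(\mathsf D_s,\mathsf D_x)$, and $-\lambda$ is the slope of a supporting line of $R$ at that point (so $\lambda=-R'$ where $R$ is differentiable). Theorem (converse bound with general $\mathsf d(\cdot,\cdot)$). Let $(\mathsf D_s,\mathsf D_x,\epsilon)$ be achievable, and let $P_{\hat X\hat S|Z}$ be any decoder with which it is achievable. Then $$\epsilon\ \ge\ \inf_{P_{Y|X}}\ \sup_{\gamma\ge 0}\Big\{\sup_{P_{\bar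 Z}}\mathbb P\big[\jmath_{S,X}(X,S,\hat X,\hat S)-\imath_{Y;\bar Z}(Y;Z)\ge\gamma\big]-\exp(-\gamma)\Big\},$$ where $(S,X,Y,Z,\hat X,\hat S)\sim P_{SX}P_{Y|X}P_{Z|Y}P_{\hat X\hat S|Z}$, the infimum is over all random encoders and the inner supremum over all probability laws on $\mathcal Z$. This holds for the tilted information of the source and, more generally, for $\jmath_{S,X}$ built from any conditional law $Q_{X|\hat X\hat S}$ and any $\lambda\ge 0$. -/

import Mathlib

open MeasureTheory ProbabilityTheory
open scoped NNReal ENNReal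

namespace HierJSCC

section System

variable {S X Y Z Xh Sh : Type*} [MeasurableSpace S] [MeasurableSpace X] [MeasurableSpace Y]
  [MeasurableSpace Z] [MeasurableSpace Xh] [MeasurableSpace Sh]

/-- The joint law `P_{SX} P_{Y|X} P_{Z|Y} P_{X̂Ŝ|Z}` of the hierarchical-source system, as a measure
on tuples `((((s, x), y), z), (x̂, ŝ))`. A deterministic encoder or decoder is a Dirac kernel. -/
noncomputable def systemLaw (PSX : Measure (S × X)) (enc : Kernel X Y) (W : Kernel Y Z)
    (dec : Kernel Z (Xh × Sh)) : Measure ((((S × X) × Y) × Z) × (Xh × Sh)) :=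
  ((PSX ⊗ₘ Kernel.prodMkLeft S enc) ⊗ₘ Kernel.prodMkLeft (S × X) W) ⊗ₘ
    Kernel.prodMkLeft ((S × X) × Y) dec

/-- The excess-distortion event `d_s(s, ŝ) > D_s` or `d_x(x, x̂) > D_x`. -/
def excessEvent (Y Z : Type*) (ds : S → Sh → ℝ≥0) (dx : X → Xh → ℝ≥0) (Ds Dx : ℝ≥0) :
    Set ((((S × X) × Y) × Z) × (Xh × Sh)) :=
  {ω | match ω with
    | ((((s, x), _), _), (xh, sh)) => Ds < ds s sh ∨ Dx < dx x xh}

/-- `(D_s, D_x, ε)` is achieved by the decoder `dec` together with some (possibly random)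
encoder. -/
def AchievableWith (PSX : Measure (S × X)) (W : Kernel Y Z) (ds : S → Sh → ℝ≥0)
    (dx : X → Xh → ℝ≥0) (dec : Kernel Z (Xh × Sh)) (Ds Dx : ℝ≥0) (ε : ℝ) : Prop :=
  ∃ enc : Kernel X Y, IsMarkovKernel enc ∧
    (systemLaw PSX enc W dec).real (excessEvent Y Z ds dx Ds Dx) ≤ ε

/-- `(D_s, D_x, ε)` is achievable: some encoder and some decoder (both possibly random) have
excess-distortion probability at most `ε`. -/
def Achievable (PSX : Measure (S × X)) (W : Kernel Y Z) (ds : S → Sh → ℝ≥0)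
    (dx : X → Xh → ℝ≥0) (Ds Dx : ℝ≥0) (ε : ℝ) : Prop :=
  ∃ dec : Kernel Z (Xh × Sh), IsMarkovKernel dec ∧ AchievableWith PSX W ds dx dec Ds Dx ε

/-- Information density of a kernel against a fixed law, `log (dκ(a) / dμ) (b)`, with values in
`[-∞, ∞]`. It is `+∞` on the part of `κ a` that is singular to `μ`, because `Kernel.rnDeriv`
is `∞` there. -/
noncomputable def infoDensity {A B : Type*} [MeasurableSpace A] [MeasurableSpace B]
    [MeasurableSpace.CountableOrCountablyGenerated A B]
    (κ : Kernel A B) (μ : Measure B) (a : A) (b : B) : EReal :=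
  ENNReal.log (Kernel.rnDeriv κ (Kernel.const A μ) a b)

/-- Tilted information
`ȷ_{S,X}(x, s, x̂, ŝ) = log (dQ_{X|X̂Ŝ}(· | x̂, ŝ) / dP_X) (x) + lam (d(d_s, d_x) - d(D_s, D_x))`
built from a conditional law `Q` of `X` given the reproductions and a multiplier `lam`. -/
noncomputable def tiltedInfo [MeasurableSpace.CountablyGenerated X]
    (PSX : Measure (S × X)) (ds : S → Sh → ℝ≥0) (dx : X → Xh → ℝ≥0)
    (d : ℝ≥0 → ℝ≥0 → ℝ) (Ds Dx : ℝ≥0) (Q : Kernel (Xh × Sh) X) (lam : ℝ)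
    (x : X) (s : S) (xh : Xh) (sh : Sh) : EReal :=
  infoDensity Q PSX.snd (xh, sh) x +
    ((lam * (d (ds s sh) (dx x xh) - d Ds Dx) : ℝ) : EReal)

/-- The converse bound for the decoder `dec`:
`inf_{P_{Y|X}} sup_{γ ≥ 0} { sup_{P_Z̄} P[ȷ_{S,X}(X,S,X̂,Ŝ) - ı_{Y;Z̄}(Y;Z) ≥ γ] - exp (-γ) }`. -/
noncomputable def converseBound [MeasurableSpace.CountablyGenerated X]
    [MeasurableSpace.CountablyGenerated Z]
    (PSX : Measure (S × X)) (W : Kernel Y Z) (ds : S → Sh → ℝ≥0) (dx : X → Xh → ℝ≥0)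
    (d : ℝ≥0 → ℝ≥0 → ℝ) (Ds Dx : ℝ≥0) (dec : Kernel Z (Xh × Sh))
    (Q : Kernel (Xh × Sh) X) (lam : ℝ) : EReal :=
  ⨅ (enc : Kernel X Y) (_ : IsMarkovKernel enc), ⨆ (γ : ℝ) (_ : 0 ≤ γ),
    ((⨆ PZbar : ProbabilityMeasure Z,
        (((systemLaw PSX enc W dec).real
          {ω | match ω with
            | ((((s, x), y), z), (xh, sh)) =>
              (γ : EReal) ≤ tiltedInfo PSX ds dx d Ds Dx Q lam x s xh sh -
                infoDensity W (PZbar : Measure Z) y z} : ℝ) : EReal)) -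
      ((Real.exp (-γ) : ℝ) : EReal))

/-- A test channel `V = P_{X̂Ŝ|X}` meets the relaxed distortion constraint
`E[d(d_s(S, Ŝ), d_x(X, X̂))] ≤ t`, where `S - X - (X̂, Ŝ)`. -/
def MeetsConstraint (PSX : Measure (S × X)) (ds : S → Sh → ℝ≥0) (dx : X → Xh → ℝ≥0)
    (d : ℝ≥0 → ℝ≥0 → ℝ) (V : Kernel X (Xh × Sh)) (t : ℝ) : Prop :=
  Integrable (fun p : (S × X) × (Xh × Sh) => d (ds p.1.1 p.2.2) (dx p.1.2 p.2.1))
      (PSX ⊗ₘ Kernel.prodMkLeft S V) ∧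
    ∫ p : (S × X) × (Xh × Sh), d (ds p.1.1 p.2.2) (dx p.1.2 p.2.1)
      ∂(PSX ⊗ₘ Kernel.prodMkLeft S V) ≤ t

/-- The mutual information `I(X; X̂, Ŝ)` for input law `P` and test channel `V`. -/
noncomputable def mutualInfo (P : Measure X) (V : Kernel X (Xh × Sh)) : ℝ≥0∞ :=
  InformationTheory.klDiv (P ⊗ₘ V) (P.prod (V ∘ₘ P))

/-- The rate-distortion function of the relaxed problem: the least `I(X; X̂, Ŝ)` over test
channels with `E[d(d_s(S, Ŝ), d_x(X, X̂))] ≤ t`. -/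
noncomputable def rateDistortion (PSX : Measure (S × X)) (ds : S → Sh → ℝ≥0)
    (dx : X → Xh → ℝ≥0) (d : ℝ≥0 → ℝ≥0 → ℝ) (t : ℝ) : ℝ≥0∞ :=
  ⨅ (V : Kernel X (Xh × Sh)) (_ : IsMarkovKernel V)
    (_ : MeetsConstraint PSX ds dx d V t), mutualInfo PSX.snd V

/-- `(Q, lam)` are the parameters `P_{X|X̂⋆Ŝ⋆}`, `lam⋆` of the tilted information at level
`t = d(D_s, D_x)`: `Q` is a version of the backward channel of a test channel that attains the
rate-distortion function at `t`, and `-lam` is the slope of a supporting line of that (convex)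
function at `t`, hence its derivative wherever it is differentiable. -/
def IsOptimalTilt (PSX : Measure (S × X)) (ds : S → Sh → ℝ≥0) (dx : X → Xh → ℝ≥0)
    (d : ℝ≥0 → ℝ≥0 → ℝ) (Ds Dx : ℝ≥0) (Q : Kernel (Xh × Sh) X) (lam : ℝ) : Prop :=
  (∃ V : Kernel X (Xh × Sh), IsMarkovKernel V ∧
    MeetsConstraint PSX ds dx d V (d Ds Dx) ∧
    mutualInfo PSX.snd V = rateDistortion PSX ds dx d (d Ds Dx) ∧
    ((V ∘ₘ PSX.snd) ⊗ₘ Q).map Prod.swap = PSX.snd ⊗ₘ V) ∧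
  0 ≤ lam ∧
  ∀ t : ℝ, (rateDistortion PSX ds dx d (d Ds Dx) : EReal) ≤
    (rateDistortion PSX ds dx d t : EReal) + ((lam * (t - d Ds Dx) : ℝ) : EReal)

end System

end HierJSCC

/-!
The bound is a change-of-measure argument. Take an encoder with which the decoder achieves the
tuple, and fix `γ` and `PZbar`. Outside the excess-distortion event, monotonicity of `d` makes the
penalty `lam * (d (ds s sh) (dx x xh) - d Ds Dx)` nonpositive, so that `γ ≤ ȷ - ı` forces
`dW_y/dPZbar (z) ≤ exp (-γ) * dQ/dPX (x)` with a finite left-hand side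
(`rnDeriv_le_of_le_tiltedInfo_sub`; the convention `∞ - ∞ = -∞` is what gives the finiteness).

Where the density of `W y` is finite, `W y` is that density times `PZbar`
(`setLIntegral_rnDeriv_ne_top_le`). On the event above the density is at most
`exp (-γ) * dQ/dPX (x)`, so the probability of the event is at most `exp (-γ)` times the integral of
`dQ/dPX` against the product of `P_X` and the law of the reproductions driven by `PZbar`; under this
product `X` is independent of the reproductions, and the integral is at most one
(`systemLaw_rnDeriv_le`). The converse bound then follows from a union bound with the excess event.
-/

open HierJSCC

section KernelDensity

variable {A B : Type*} [MeasurableSpace A] [MeasurableSpace B]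
  [MeasurableSpace.CountableOrCountablyGenerated A B]

/-- On the set where the density is finite, a kernel has no singular part. -/
lemma setLIntegral_rnDeriv_ne_top_le (κ η : Kernel A B) [IsFiniteKernel κ] [IsFiniteKernel η]
    (a : A) {f : B → ℝ≥0∞} (hf : Measurable f) :
    ∫⁻ b in {b | κ.rnDeriv η a b ≠ ∞}, f b ∂κ a ≤ ∫⁻ b, κ.rnDeriv η a b * f b ∂η a := by
  have hset : {b | κ.rnDeriv η a b ≠ ∞} = (Kernel.mutuallySingularSetSlice κ η a)ᶜ := by
    ext b
    simp [Kernel.rnDeriv_eq_top_iff']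
  have hle : (κ a).restrict {b | κ.rnDeriv η a b ≠ ∞} ≤ (η a).withDensity (κ.rnDeriv η a) := by
    rw [hset, ← Kernel.withDensity_apply η (Kernel.measurable_rnDeriv κ η)]
    refine Measure.le_iff.2 fun s hs => ?_
    have hT := (Kernel.measurableSet_mutuallySingularSetSlice κ η a).compl
    rw [Measure.restrict_apply hs,
      ← Kernel.withDensity_rnDeriv_of_subset_compl_mutuallySingularSetSlice (hs.inter hT)
        Set.inter_subset_right]
    exact measure_mono Set.inter_subset_left
  calc _ ≤ ∫⁻ b, f b ∂(η a).withDensity (κ.rnDeriv η a) := lintegral_mono' hle le_rfl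
    _ = _ := lintegral_withDensity_eq_lintegral_mul _ (Kernel.measurable_rnDeriv_right κ η a) hf

lemma lintegral_rnDeriv_le (κ η : Kernel A B) [IsFiniteKernel κ] [IsFiniteKernel η] (a : A) :
    ∫⁻ b, κ.rnDeriv η a b ∂η a ≤ κ a Set.univ := by
  have h := congrArg (fun ν : Kernel A B => ν a Set.univ) (Kernel.rnDeriv_add_singularPart κ η)
  simp only [FunLike.coe_add, Pi.add_apply, Measure.coe_add,
    Kernel.withDensity_apply' η (Kernel.measurable_rnDeriv κ η), Measure.restrict_univ] at h
  exact le_self_add.trans_eq h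

end KernelDensity

section Converse

variable {S X Y Z Xh Sh : Type*} [MeasurableSpace S] [MeasurableSpace X] [MeasurableSpace Y]
  [MeasurableSpace Z] [MeasurableSpace Xh] [MeasurableSpace Sh]
  [MeasurableSpace.CountablyGenerated X] [MeasurableSpace.CountablyGenerated Z]

lemma rnDeriv_le_of_le_tiltedInfo_sub (PSX : Measure (S × X)) (W : Kernel Y Z)
    {ds : S → Sh → ℝ≥0} {dx : X → Xh → ℝ≥0} {d : ℝ≥0 → ℝ≥0 → ℝ}
    (hd : ∀ a a' b b' : ℝ≥0, a ≤ a' → b ≤ b' → d a b ≤ d a' b') {Ds Dx : ℝ≥0}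
    (Q : Kernel (Xh × Sh) X) {lam : ℝ} (hlam : 0 ≤ lam) (μ : Measure Z) {γ : ℝ}
    {s : S} {x : X} {y : Y} {z : Z} {xh : Xh} {sh : Sh}
    (hs : ds s sh ≤ Ds) (hx : dx x xh ≤ Dx)
    (h : (γ : EReal) ≤ tiltedInfo PSX ds dx d Ds Dx Q lam x s xh sh - infoDensity W μ y z) :
    W.rnDeriv (Kernel.const Y μ) y z ≠ ∞ ∧
      W.rnDeriv (Kernel.const Y μ) y z ≤
        ENNReal.ofReal (Real.exp (-γ)) * Q.rnDeriv (Kernel.const _ PSX.snd) (xh, sh) x := by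
  unfold tiltedInfo infoDensity at h
  set w := W.rnDeriv (Kernel.const Y μ) y z
  set q := Q.rnDeriv (Kernel.const _ PSX.snd) (xh, sh) x
  refine ⟨fun hw => by simp [hw] at h, ?_⟩
  have hpen : lam * (d (ds s sh) (dx x xh) - d Ds Dx) ≤ 0 :=
    mul_nonpos_of_nonneg_of_nonpos hlam (sub_nonpos.2 (hd _ _ _ _ hs hx))
  have hlog : (γ : EReal) + ENNReal.log w ≤ ENNReal.log q := by
    refine EReal.add_le_of_le_sub (h.trans (EReal.sub_le_sub ?_ le_rfl))
    calc _ ≤ ENNReal.log q + 0 := by gcongr; exact_mod_cast hpen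
      _ = _ := add_zero _
  have hmul : ENNReal.ofReal (Real.exp γ) * w ≤ q := by
    simpa [EReal.exp_add] using EReal.exp_monotone hlog
  calc w = ENNReal.ofReal (Real.exp (-γ)) * (ENNReal.ofReal (Real.exp γ) * w) := by
        rw [← mul_assoc, ← ENNReal.ofReal_mul (Real.exp_nonneg _), ← Real.exp_add]
        simp
    _ ≤ _ := by gcongr

/-- The change of measure from `W y` to `PZbar`, which makes `X` independent of the
reproductions. -/
lemma systemLaw_rnDeriv_le (PSX : Measure (S × X)) [IsProbabilityMeasure PSX]
    (enc : Kernel X Y) [IsMarkovKernel enc] (W : Kernel Y Z) [IsMarkovKernel W]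
    (dec : Kernel Z (Xh × Sh)) [IsMarkovKernel dec] (Q : Kernel (Xh × Sh) X) [IsMarkovKernel Q]
    (μ : Measure Z) [IsProbabilityMeasure μ] (c : ℝ≥0∞) :
    systemLaw PSX enc W dec
      {ω | W.rnDeriv (Kernel.const Y μ) ω.1.1.2 ω.1.2 ≠ ∞ ∧
        W.rnDeriv (Kernel.const Y μ) ω.1.1.2 ω.1.2 ≤
          c * Q.rnDeriv (Kernel.const _ PSX.snd) ω.2 ω.1.1.1.2} ≤ c := by
  set w : Y → Z → ℝ≥0∞ := W.rnDeriv (Kernel.const Y μ)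
  set q : Xh × Sh → X → ℝ≥0∞ := Q.rnDeriv (Kernel.const _ PSX.snd)
  have hw : Measurable fun p : Y × Z => w p.1 p.2 := Kernel.measurable_rnDeriv _ _
  have hq : Measurable fun p : (Xh × Sh) × X => q p.1 p.2 := Kernel.measurable_rnDeriv _ _
  set E : Set ((((S × X) × Y) × Z) × (Xh × Sh)) :=
    {ω | w ω.1.1.2 ω.1.2 ≠ ∞ ∧ w ω.1.1.2 ω.1.2 ≤ c * q ω.2 ω.1.1.1.2}
  have hwE : Measurable fun ω : (((S × X) × Y) × Z) × (Xh × Sh) => w ω.1.1.2 ω.1.2 :=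
    hw.comp (by fun_prop : Measurable
      fun ω : (((S × X) × Y) × Z) × (Xh × Sh) => (ω.1.1.2, ω.1.2))
  have hqE : Measurable fun ω : (((S × X) × Y) × Z) × (Xh × Sh) => c * q ω.2 ω.1.1.1.2 :=
    (hq.comp (by fun_prop : Measurable
      fun ω : (((S × X) × Y) × Z) × (Xh × Sh) => (ω.2, ω.1.1.1.2))).const_mul c
  have hE : MeasurableSet E :=
    (hwE (measurableSet_singleton ∞).compl).inter (measurableSet_le hwE hqE)
  have hdec : Measurable fun p : ((S × X) × Y) × Z => dec p.2 (Prod.mk p ⁻¹' E) :=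
    Kernel.measurable_kernel_prodMk_left (κ := Kernel.prodMkLeft ((S × X) × Y) dec) hE
  -- the law of the reproductions when the decoder is driven by `μ`
  set ν : Measure (Xh × Sh) := dec ∘ₘ μ
  have hqx (x : X) : Measurable fun p => q p x := hq.comp measurable_prodMk_right
  have hcond (p : (S × X) × Y) :
      ∫⁻ z, dec z (Prod.mk (p, z) ⁻¹' E) ∂W p.2 ≤ c * ∫⁻ r, q r p.1.2 ∂ν := by
    have hm : Measurable fun z => dec z (Prod.mk (p, z) ⁻¹' E) :=
      hdec.comp measurable_prodMk_left
    have hT : MeasurableSet {z | w p.2 z ≠ ∞} :=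
      (hw.comp measurable_prodMk_left) (measurableSet_singleton ∞).compl
    calc ∫⁻ z, dec z (Prod.mk (p, z) ⁻¹' E) ∂W p.2
        = ∫⁻ z in {z | w p.2 z ≠ ∞}, dec z (Prod.mk (p, z) ⁻¹' E) ∂W p.2 := by
          rw [← lintegral_indicator hT]
          refine lintegral_congr fun z => ?_
          by_cases hz : w p.2 z = ∞
          · have : Prod.mk (p, z) ⁻¹' E = ∅ := by ext r; simp [E, hz]
            rw [this, measure_empty, Set.indicator_of_notMem (by simpa using hz)]
          · simp [hz]
      _ ≤ ∫⁻ z, w p.2 z * dec z (Prod.mk (p, z) ⁻¹' E) ∂μ :=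
          setLIntegral_rnDeriv_ne_top_le W (Kernel.const Y μ) p.2 hm
      _ ≤ ∫⁻ z, ∫⁻ r, c * q r p.1.2 ∂dec z ∂μ := by
          refine lintegral_mono fun z => ?_
          rw [← setLIntegral_const]
          exact (setLIntegral_mono ((hqx _).const_mul c) fun r hr => hr.2).trans
            (setLIntegral_le_lintegral _ _)
      _ = c * ∫⁻ r, q r p.1.2 ∂ν := by
          rw [← Measure.lintegral_bind dec.aemeasurable ((hqx _).const_mul c).aemeasurable,
            lintegral_const_mul _ (hqx _)]
  have hg : Measurable fun x => ∫⁻ r, q r x ∂ν := hq.lintegral_prod_left'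
  have hdec' : Measurable fun p : (S × X) × Y => ∫⁻ z, dec z (Prod.mk (p, z) ⁻¹' E) ∂W p.2 :=
    hdec.lintegral_kernel_prod_right' (κ := Kernel.prodMkLeft (S × X) W)
  calc systemLaw PSX enc W dec E
      = ∫⁻ p, ∫⁻ z, dec z (Prod.mk (p, z) ⁻¹' E) ∂W p.2
          ∂(PSX ⊗ₘ Kernel.prodMkLeft S enc) := by
        rw [systemLaw, Measure.compProd_apply hE]
        exact Measure.lintegral_compProd hdec
    _ ≤ ∫⁻ p, c * ∫⁻ r, q r p.1.2 ∂ν ∂(PSX ⊗ₘ Kernel.prodMkLeft S enc) := lintegral_mono hcond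
    _ = c * ∫⁻ x, ∫⁻ r, q r x ∂ν ∂PSX.snd := by
        have hgp : Measurable fun p : (S × X) × Y => c * ∫⁻ r, q r p.1.2 ∂ν :=
          (hg.comp (measurable_snd.comp measurable_fst)).const_mul c
        rw [Measure.lintegral_compProd hgp, Measure.snd, lintegral_map hg measurable_snd]
        simpa using lintegral_const_mul c (hg.comp measurable_snd)
    _ = c * ∫⁻ r, ∫⁻ x, q r x ∂PSX.snd ∂ν := by
        rw [lintegral_lintegral_swap (f := fun x r => q r x)
          (hq.comp measurable_swap).aemeasurable]
    _ ≤ c * ∫⁻ r, 1 ∂ν := by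
        gcongr with r
        exact (lintegral_rnDeriv_le Q (Kernel.const _ PSX.snd) r).trans_eq measure_univ
    _ = c := by simp

lemma converseBound_le (PSX : Measure (S × X)) [IsProbabilityMeasure PSX]
    (W : Kernel Y Z) [IsMarkovKernel W] (ds : S → Sh → ℝ≥0) (dx : X → Xh → ℝ≥0)
    (Ds Dx : ℝ≥0) {ε : ℝ} (d : ℝ≥0 → ℝ≥0 → ℝ)
    (hd : ∀ a a' b b' : ℝ≥0, a ≤ a' → b ≤ b' → d a b ≤ d a' b')
    (dec : Kernel Z (Xh × Sh)) [IsMarkovKernel dec]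
    (hach : AchievableWith PSX W ds dx dec Ds Dx ε)
    (Q : Kernel (Xh × Sh) X) [IsMarkovKernel Q] {lam : ℝ} (hlam : 0 ≤ lam) :
    converseBound PSX W ds dx d Ds Dx dec Q lam ≤ (ε : EReal) := by
  obtain ⟨enc, henc, hε⟩ := hach
  have : IsProbabilityMeasure (systemLaw PSX enc W dec) := by unfold systemLaw; infer_instance
  refine iInf₂_le_of_le enc henc (iSup₂_le fun γ _ => ?_)
  refine EReal.sub_le_of_le_add (iSup_le fun PZbar => ?_)
  set μ : Measure Z := (PZbar : Measure Z)
  set c := Real.exp (-γ)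
  set F : Set ((((S × X) × Y) × Z) × (Xh × Sh)) :=
    {ω | W.rnDeriv (Kernel.const Y μ) ω.1.1.2 ω.1.2 ≠ ∞ ∧
      W.rnDeriv (Kernel.const Y μ) ω.1.1.2 ω.1.2 ≤
        ENNReal.ofReal c * Q.rnDeriv (Kernel.const _ PSX.snd) ω.2 ω.1.1.1.2}
  have hF : (systemLaw PSX enc W dec).real F ≤ c :=
    ENNReal.toReal_le_of_le_ofReal (Real.exp_nonneg _) (systemLaw_rnDeriv_le PSX enc W dec Q μ _)
  rw [← EReal.coe_add, EReal.coe_le_coe_iff]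
  -- `d` need not be Borel measurable, so the event on the left may fail to be measurable: only
  -- monotonicity and subadditivity of the outer measure are used
  refine (measureReal_mono (s₂ := excessEvent Y Z ds dx Ds Dx ∪ F) ?_).trans
    ((measureReal_union_le _ _).trans (add_le_add hε hF))
  rintro ⟨⟨⟨⟨s, x⟩, y⟩, z⟩, xh, sh⟩ h
  by_cases hex : Ds < ds s sh ∨ Dx < dx x xh
  · exact Or.inl hex
  · rw [not_or, not_lt, not_lt] at hex
    exact Or.inr (rnDeriv_le_of_le_tiltedInfo_sub PSX W hd Q hlam μ hex.1 hex.2 h)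

end Converse

open HierJSCC in
theorem theorem1 {S X Y Z Xh Sh : Type*} [MeasurableSpace S] [MeasurableSpace X]
    [MeasurableSpace Y] [MeasurableSpace Z] [MeasurableSpace Xh] [MeasurableSpace Sh]
    [MeasurableSpace.CountablyGenerated X] [MeasurableSpace.CountablyGenerated Z]
    (PSX : Measure (S × X)) [IsProbabilityMeasure PSX]
    (W : Kernel Y Z) [IsMarkovKernel W]
    (ds : S → Sh → ℝ≥0) (hds : Measurable (Function.uncurry ds))
    (dx : X → Xh → ℝ≥0) (hdx : Measurable (Function.uncurry dx))
    (Ds Dx : ℝ≥0) (ε : ℝ)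
    (hach : Achievable PSX W ds dx Ds Dx ε)
    (d : ℝ≥0 → ℝ≥0 → ℝ)
    (hd : ∀ a a' b b' : ℝ≥0, a ≤ a' → b ≤ b' → d a b ≤ d a' b') :
    -- every decoder that achieves the tuple
    ∀ dec : Kernel Z (Xh × Sh), IsMarkovKernel dec →
      AchievableWith PSX W ds dx dec Ds Dx ε →
      -- the tilted information of the relaxed rate-distortion problem
      (∀ (Q : Kernel (Xh × Sh) X) (lam : ℝ), IsMarkovKernel Q →
        IsOptimalTilt PSX ds dx d Ds Dx Q lam →
        converseBound PSX W ds dx d Ds Dx dec Q lam ≤ (ε : EReal)) ∧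
      -- more generally, every reference conditional law and every nonnegative multiplier
      (∀ (Q : Kernel (Xh × Sh) X) (lam : ℝ), IsMarkovKernel Q → 0 ≤ lam →
        converseBound PSX W ds dx d Ds Dx dec Q lam ≤ (ε : EReal)) := by
  intro dec hdec hachdec
  have key (Q : Kernel (Xh × Sh) X) (lam : ℝ) (hQ : IsMarkovKernel Q) (hlam : 0 ≤ lam) :
      converseBound PSX W ds dx d Ds Dx dec Q lam ≤ (ε : EReal) :=
    converseBound_le PSX W ds dx Ds Dx d hd dec hachdec Q hlam
  exact ⟨fun Q lam hQ hopt => key Q lam hQ hopt.2.1, key⟩
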